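/- Let $\mathbb{F}_q$ be a finite field with $q$ odd, and let $\widehat{\mathbb{F}_q^\times}$ be the group of multiplicative characters $\mathbb{F}_q^\times\to\mathbb{C}^\times$, each extended to $\mathbb{F}_q$ by $\chi(0)=0$ (including the trivial character $\varepsilon$). Write $\overline{\chi}=\chi^{-1}$, let $\phi$ be the quadratic character, and let $J(\chi,\psi)=\sum_{x\in\mathbb{F}_q}\chi(x)\psi(1-x)$. For characters $A_1,A_2,B_1$ and $\lambda\in\mathbb{F}_q$ put $${}_2\mathbb{F}_1\left[\begin{matrix}A_1 & A_2\\ & B_1\end{matrix};\lambda\right]=\frac{1}{J(A_2,B_1\overline{A_2})}\sum_{y\in\mathbb{F}_q}A_2(y)\,\overline{A_2}B_1(1-y)\,\overline{A_1}(1-\lambda y).$$ Theorem. Let $A,B\in\widehat{\mathbb{F}_q^\times}$ be such that $B\neq\varepsilon$, $B^2\overline{A}\neq\varepsilon$ and $A\overline{B}\phi\neq\varepsilon$. Then for every $z\in\mathbb{F}_q$ with $z\neq\pm1$, $${}_2\mathbb{F}_1\left[\begin{matrix}A & B\\ & B^2\end{matrix};\frac{4z}{(1+z)^2}\right]=A^2(1+z)\;{}_2\mathbb{F}_1\left[\begin{matrix}A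 & A\phi\overline{B}\\ & B\phi\end{matrix};z^2\right],$$ where $A^2(1+z)$ denotes the value of the character $A^2$ at $1+z$. -/

import Mathlib

namespace FFHyp

noncomputable section

variable {F : Type*} [Field F] [Fintype F]

/-- The quadratic character of `F`, as a complex-valued multiplicative character
(it vanishes at `0`; for odd characteristic it is the unique character of order two). -/
def phi (F : Type*) [Field F] [Fintype F] [DecidableEq F] : MulChar F ℂ :=
  (quadraticChar F).ringHomComp (Int.castRingHom ℂ)

/-- The period function `₁ℙ₀[A; x] = Ā(1 - x)`. As everywhere in Mathlib's `MulChar`,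
every character, including the trivial one, takes the value `0` at `0`. -/
def period10 (A : MulChar F ℂ) (x : F) : ℂ :=
  A⁻¹ (1 - x)

/-- The period function
`₂ℙ₁[A₁, A₂; B₁; t] = ∑ y, A₂(y) (Ā₂B₁)(1 - y) ₁ℙ₀[A₁; t y]`. -/
def period21 (A₁ A₂ B₁ : MulChar F ℂ) (t : F) : ℂ :=
  ∑ y : F, A₂ y * (A₂⁻¹ * B₁) (1 - y) * period10 A₁ (t * y)

/-- The normalized hypergeometric function
`₂𝔽₁[A₁, A₂; B₁; t] = ₂ℙ₁[A₁, A₂; B₁; t] / J(A₂, B₁Ā₂)`, where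
`J(χ, ψ) = ∑ x, χ(x) ψ(1 - x)` is the Jacobi sum. -/
def hyp21 (A₁ A₂ B₁ : MulChar F ℂ) (t : F) : ℂ :=
  1 / jacobiSum A₂ (B₁ * A₂⁻¹) * period21 A₁ A₂ B₁ t

end

end FFHyp

namespace FFHyp

open Finset

/-! Finite-field version of a double-integral proof. With `y = (t + 1) / 2` the left period becomes,
up to `A ^ 2 (1 + z)` and `B 4`, the sum S of `B (1 - t ^ 2) * A⁻¹ (1 - 2 * t * z + z ^ 2)`.
Multiplying S by the Jacobi sum normalizing the right side, and the right period by J(φ, B), turns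
both into sums weighted by `A⁻¹ (2 * z * m - 1 - z ^ 2)` (`jacobiSum_mul_sum_left`,
`jacobiSum_mul_sum_right`), where on the right m comes from x + 1/x = 2m.

The weighted terms agree for each m separately (`sum_phi_mul_eq_sum_fiber`), because φ summed over
the solutions of y + 1/y = v is φ(v + 2) + φ(v - 2). The duplication formula J(B, B) B(4) = J(φ, B)
then matches the normalizations. -/

/-- The nonzero solutions of `y + y⁻¹ = 2m` are `m ± n` when `m² - 1 = n²`. -/
lemma add_inv_eq_iff {F : Type*} [Field F] {m n : F} (hn : m ^ 2 - 1 = n ^ 2) (y : F) :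
    y ≠ 0 ∧ y + y⁻¹ = 2 * m ↔ y = m + n ∨ y = m - n := by
  have key : y ≠ 0 → (y + y⁻¹ = 2 * m ↔ (y - (m + n)) * (y - (m - n)) = 0) := by
    intro hy
    constructor
    · intro h
      have : y * y⁻¹ = 1 := mul_inv_cancel₀ hy
      linear_combination y * h - this + hn
    · intro h
      field_simp
      linear_combination h - hn
  constructor
  · rintro ⟨hy, h⟩
    rcases mul_eq_zero.mp ((key hy).mp h) with h | h
    · exact Or.inl (sub_eq_zero.mp h)
    · exact Or.inr (sub_eq_zero.mp h)
  · intro h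
    have hy : y ≠ 0 := by
      rintro rfl
      have : (m + n) * (m - n) = 0 := by rcases h with h | h <;> simp [← h]
      apply one_ne_zero (α := F)
      linear_combination this - hn
    refine ⟨hy, (key hy).mpr ?_⟩
    rcases h with h | h <;> simp [h]

/-! ### Sums of the quadratic character over fibres of y + 1/y. -/

section QuadraticCharacter

variable {F : Type*} [Field F] [Fintype F] [DecidableEq F]

lemma phi_apply (x : F) : phi F x = (quadraticChar F x : ℂ) := rfl

lemma phi_sq {x : F} (hx : x ≠ 0) : phi F (x ^ 2) = 1 := by
  rw [phi_apply, quadraticChar_sq_one' hx, Int.cast_one]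

lemma phi_mul_self {x : F} (hx : x ≠ 0) : phi F x * phi F x = 1 := by
  rw [← map_mul, ← sq, phi_sq hx]

lemma phi_inv (x : F) : phi F x⁻¹ = phi F x := by
  rcases eq_or_ne x 0 with rfl | hx
  · simp
  · calc phi F x⁻¹ = phi F (x⁻¹ * x ^ 2) := by rw [map_mul, phi_sq hx, mul_one]
      _ = phi F x := by congr 1; field_simp

lemma phi_of_not_isSquare {x : F} (hx : ¬IsSquare x) : phi F x = -1 := by
  rw [phi_apply, quadraticChar_neg_one_iff_not_isSquare.mpr hx]
  simp

lemma sum_add_inv_fiber_of_sq (h2 : (2 : F) ≠ 0) {m n : F} (hn : m ^ 2 - 1 = n ^ 2) (hn0 : n ≠ 0)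
    (f : F → ℂ) : ∑ y ∈ univ.filter (fun y : F => y ≠ 0 ∧ y + y⁻¹ = 2 * m), f y =
      f (m + n) + f (m - n) := by
  rw [← sum_pair (f := f) (a := m + n) (b := m - n)]
  · congr 1
    ext y
    simp only [mem_filter, mem_univ, true_and, add_inv_eq_iff hn, mem_insert, mem_singleton]
  · intro h
    have : 2 * n = 0 := by linear_combination h
    simp_all

lemma sum_add_inv_fiber_of_zero {m : F} (hm : m ^ 2 - 1 = 0)
    (f : F → ℂ) : ∑ y ∈ univ.filter (fun y : F => y ≠ 0 ∧ y + y⁻¹ = 2 * m), f y = f m := by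
  rw [← sum_singleton f m]
  congr 1
  ext y
  simp only [mem_filter, mem_univ, true_and, mem_singleton,
    add_inv_eq_iff (n := 0) (by simpa using hm) y]
  simp

lemma sum_add_inv_fiber_of_not_isSquare {m : F} (hm : ¬IsSquare (m ^ 2 - 1))
    (f : F → ℂ) : ∑ y ∈ univ.filter (fun y : F => y ≠ 0 ∧ y + y⁻¹ = 2 * m), f y = 0 := by
  rw [filter_eq_empty_iff.mpr, sum_empty]
  rintro y - ⟨hy, h⟩
  refine hm ⟨y - m, ?_⟩
  have : y * y⁻¹ = 1 := mul_inv_cancel₀ hy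
  linear_combination (-y) * h + this

/-- On the fibre, (y ± 1)² = y(v ± 2), so φ(y) equals each of φ(v ± 2) that is nonzero. If v² - 4 is
a nonsquare, the fibre is empty and the two values on the right cancel. -/
lemma sum_phi_add_inv_fiber (h2 : (2 : F) ≠ 0) (v : F) :
    ∑ y ∈ univ.filter (fun y : F => y ≠ 0 ∧ y + y⁻¹ = v), phi F y =
      phi F (v + 2) + phi F (v - 2) := by
  obtain ⟨m, rfl⟩ : ∃ m, v = 2 * m := ⟨v / 2, by field_simp⟩
  have h4 : phi F (2 * m + 2) = phi F 2 * phi F (m + 1) := by rw [← map_mul]; ring_nf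
  have h5 : phi F (2 * m - 2) = phi F 2 * phi F (m - 1) := by rw [← map_mul]; ring_nf
  have h22 := phi_mul_self h2
  rw [h4, h5]
  by_cases hs : IsSquare (m ^ 2 - 1)
  · obtain ⟨n, hn⟩ := hs
    rw [← sq] at hn
    rcases eq_or_ne n 0 with rfl | hn0
    · have hm : m ^ 2 - 1 = 0 := by simpa using hn
      rw [sum_add_inv_fiber_of_zero hm]
      have : (m - 1) * (m + 1) = 0 := by linear_combination hm
      rcases mul_eq_zero.mp this with h | h
      · obtain rfl : m = 1 := sub_eq_zero.mp h
        rw [sub_self, MulChar.map_zero, one_add_one_eq_two, map_one, h22]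
        ring
      · obtain rfl : m = -1 := eq_neg_of_add_eq_zero_left h
        rw [show (-1 - 1 : F) = -1 * 2 by ring, map_mul]
        simp only [neg_add_cancel, MulChar.map_zero]
        linear_combination -phi F (-1) * h22
    · rw [sum_add_inv_fiber_of_sq h2 hn hn0]
      have hprod : (m + n) * (m - n) = 1 := by linear_combination hn
      have hy : m + n ≠ 0 := left_ne_zero_of_mul_eq_one hprod
      have hm' : (m - 1) * (m + 1) ≠ 0 := by
        intro h
        apply pow_ne_zero 2 hn0
        linear_combination h - hn
      have hinv : m - n = (m + n)⁻¹ := (eq_inv_of_mul_eq_one_right hprod)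
      rw [hinv, phi_inv]
      have e1 : phi F 2 * phi F (m + 1) * phi F (m + n) = 1 := by
        rw [← map_mul, ← map_mul, show 2 * (m + 1) * (m + n) = (m + n + 1) ^ 2 by
          linear_combination hn]
        refine phi_sq fun h => ?_
        apply right_ne_zero_of_mul hm'
        have : m + n = -1 := by linear_combination h
        rw [this] at hprod
        have h' : 2 * (m + 1) = 0 := by linear_combination this - hprod
        exact (mul_eq_zero.mp h').resolve_left h2
      have e2 : phi F 2 * phi F (m - 1) * phi F (m + n) = 1 := by
        rw [← map_mul, ← map_mul, show 2 * (m - 1) * (m + n) = (m + n - 1) ^ 2 by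
          linear_combination hn]
        refine phi_sq fun h => ?_
        apply left_ne_zero_of_mul hm'
        have : m + n = 1 := by linear_combination h
        rw [this] at hprod
        have h' : 2 * (m - 1) = 0 := by linear_combination this + hprod
        exact (mul_eq_zero.mp h').resolve_left h2
      have e3 := phi_mul_self hy
      linear_combination (-phi F (m + n)) * (e1 + e2) +
        (phi F 2 * phi F (m + 1) + phi F 2 * phi F (m - 1)) * e3
  · rw [sum_add_inv_fiber_of_not_isSquare hs]
    have h0 : (m + 1) * (m - 1) ≠ 0 := by
      intro h
      exact hs ⟨0, by linear_combination h⟩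
    have e1 : phi F (m + 1) * phi F (m - 1) = -1 := by
      rw [← map_mul, show (m + 1) * (m - 1) = m ^ 2 - 1 by ring, phi_of_not_isSquare hs]
    have e2 := phi_mul_self (left_ne_zero_of_mul h0)
    linear_combination (phi F 2 * phi F (m - 1)) * e2 - (phi F 2 * phi F (m + 1)) * e1

lemma sum_filter_ne_zero_fiberwise (f : F → ℂ) (g : F → F) :
    ∑ v, ∑ y ∈ univ.filter (fun y : F => y ≠ 0 ∧ g y = v), f y =
      ∑ y ∈ univ.filter (fun y : F => y ≠ 0), f y := by
  rw [← sum_fiberwise (univ.filter (fun y : F => y ≠ 0)) g]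
  simp only [filter_filter]

lemma sum_phi_mul_add_inv (h2 : (2 : F) ≠ 0) (f : F → ℂ) :
    ∑ y, phi F y * f (y + y⁻¹) = ∑ v, (phi F (v + 2) + phi F (v - 2)) * f v := by
  simp_rw [← sum_phi_add_inv_fiber h2, sum_mul]
  have : ∀ v, ∑ y ∈ univ.filter (fun y : F => y ≠ 0 ∧ y + y⁻¹ = v), phi F y * f v =
      ∑ y ∈ univ.filter (fun y : F => y ≠ 0 ∧ y + y⁻¹ = v), phi F y * f (y + y⁻¹) := by
    intro v
    refine sum_congr rfl fun y hy => ?_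
    rw [(mem_filter.mp hy).2.2]
  simp_rw [this]
  rw [sum_filter_ne_zero_fiberwise, sum_filter]
  refine sum_congr rfl fun y _ => ?_
  by_cases hy : y = 0 <;> simp [hy, MulChar.map_zero]

/-- The m-by-m comparison of the two double sums. If m² - 1 = n² ≠ 0, then x = m ± n, and the two
shifts on the right are ∓2nP with P = (z - 1/z)/2 ≠ 0, up to order; they match the φ(v ± 2) of the
fibre count. -/
lemma sum_phi_mul_eq_sum_fiber (h2 : (2 : F) ≠ 0) {z : F} (hz0 : z ≠ 0) (hz : z ≠ 1)
    (hz' : z ≠ -1) (f : F → ℂ) (m : F) :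
    ∑ y, phi F y * f ((m ^ 2 - 1) * y + ((z - z⁻¹) / 2) ^ 2 * y⁻¹) =
      ∑ x ∈ univ.filter (fun x : F => x ≠ 0 ∧ x + x⁻¹ = 2 * m),
        ∑ u, phi F u * f (u + (m * (z + z⁻¹) - x / z - z / x)) := by
  set P : F := (z - z⁻¹) / 2 with hP
  have hP0 : P ≠ 0 := by
    intro h
    have h1 : (z - 1) * (z + 1) = 0 := by
      rw [hP] at h
      field_simp at h
      linear_combination h
    rcases mul_eq_zero.mp h1 with h1 | h1
    · exact hz (sub_eq_zero.mp h1)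
    · exact hz' (eq_neg_of_add_eq_zero_left h1)
  by_cases hs : IsSquare (m ^ 2 - 1)
  · obtain ⟨n, hn⟩ := hs
    rw [← sq] at hn
    rcases eq_or_ne n 0 with rfl | hn0
    · have hm : m ^ 2 - 1 = 0 := by simpa using hn
      have hm0 : m ≠ 0 := by rintro rfl; simp at hm
      rw [sum_add_inv_fiber_of_zero hm, hm]
      have h0 : m * (z + z⁻¹) - m / z - z / m = 0 := by
        field_simp
        linear_combination z ^ 2 * hm
      rw [h0]
      -- Only the term P²/y survives when m² = 1; substitute u = P²/y.
      refine Fintype.sum_equiv ((Equiv.inv F).trans (Equiv.mulLeft₀ (P ^ 2) (pow_ne_zero 2 hP0)))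
        _ _ fun y => ?_
      simp only [Equiv.trans_apply, Equiv.inv_apply, Equiv.mulLeft₀_apply, map_mul, phi_inv,
        phi_sq hP0]
      simp
    · have hprod : (m + n) * (m - n) = 1 := by linear_combination hn
      rw [sum_add_inv_fiber_of_sq h2 hn hn0]
      have hy : m + n ≠ 0 := left_ne_zero_of_mul_eq_one hprod
      have hy' : m - n ≠ 0 := right_ne_zero_of_mul_eq_one hprod
      have e1 : m * (z + z⁻¹) - (m + n) / z - z / (m + n) = n * P * 2 := by
        rw [div_eq_mul_inv z, ← eq_inv_of_mul_eq_one_right hprod, hP]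
        field_simp
        ring
      have e2 : m * (z + z⁻¹) - (m - n) / z - z / (m - n) = -(n * P * 2) := by
        rw [div_eq_mul_inv z, ← eq_inv_of_mul_eq_one_left hprod, hP]
        field_simp
        ring
      rw [e1, e2, hn]
      have hnP : n * P ≠ 0 := mul_ne_zero hn0 hP0
      -- Scaling y by P/n balances the coefficients n² and P² into the common factor nP.
      have step1 : ∑ y, phi F y * f (n ^ 2 * y + P ^ 2 * y⁻¹) =
          ∑ y, phi F y * (phi F (n * P) * f (n * P * (y + y⁻¹))) := by
        refine (Fintype.sum_equiv (Equiv.mulLeft₀ (P / n) (div_ne_zero hP0 hn0)) _ _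
          fun y => ?_).symm
        rcases eq_or_ne y 0 with rfl | hy
        · simp [MulChar.map_zero]
        simp only [Equiv.mulLeft₀_apply]
        rw [div_eq_mul_inv, map_mul _ (P * n⁻¹), map_mul _ P, phi_inv, map_mul _ n]
        have : n * P * (y + y⁻¹) = n ^ 2 * (P * n⁻¹ * y) + P ^ 2 * (P * n⁻¹ * y)⁻¹ := by
          field_simp
        rw [this]
        ring
      rw [step1, sum_phi_mul_add_inv h2 (fun v => phi F (n * P) * f (n * P * v))]
      simp_rw [add_mul]
      rw [sum_add_distrib, add_comm]
      congr 1
      · refine Fintype.sum_equiv ((Equiv.subRight 2).trans (Equiv.mulLeft₀ _ hnP)) _ _ fun v => ?_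
        simp only [Equiv.trans_apply, Equiv.subRight_apply, Equiv.mulLeft₀_apply, map_mul]
        rw [show n * P * (v - 2) + n * P * 2 = n * P * v by ring]
        ring
      · refine Fintype.sum_equiv ((Equiv.addRight 2).trans (Equiv.mulLeft₀ _ hnP)) _ _ fun v => ?_
        simp only [Equiv.trans_apply, Equiv.coe_addRight, Equiv.mulLeft₀_apply, map_mul]
        rw [show n * P * (v + 2) + -(n * P * 2) = n * P * v by ring]
        ring
  · rw [sum_add_inv_fiber_of_not_isSquare hs]
    set d := m ^ 2 - 1 with hd
    have hd0 : d ≠ 0 := by intro h; exact hs (h ▸ IsSquare.zero)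
    -- The involution y ↦ P²/(dy) fixes the argument of f and, d being a nonsquare, reverses the
    -- sign of φ, so the sum vanishes.
    refine self_eq_neg.mp ?_
    rw [← sum_neg_distrib]
    refine Fintype.sum_equiv ((Equiv.inv F).trans (Equiv.mulLeft₀ (P ^ 2 / d)
      (div_ne_zero (pow_ne_zero 2 hP0) hd0))) _ _ fun y => ?_
    rcases eq_or_ne y 0 with rfl | hy
    · simp [MulChar.map_zero]
    simp only [Equiv.trans_apply, Equiv.inv_apply, Equiv.mulLeft₀_apply]
    rw [map_mul, div_eq_mul_inv, map_mul, phi_inv, phi_inv, phi_sq hP0, phi_of_not_isSquare hs]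
    have : d * (P ^ 2 * d⁻¹ * y⁻¹) + P ^ 2 * (P ^ 2 * d⁻¹ * y⁻¹)⁻¹ = d * y + P ^ 2 * y⁻¹ := by
      field_simp
      ring
    rw [this]
    ring

end QuadraticCharacter

lemma inv_apply_inv {F : Type*} [Field F] (A : MulChar F ℂ) (x : F) : A⁻¹ x⁻¹ = A x := by
  rw [MulChar.inv_apply', inv_inv]

/-! ### Both periods as double sums, and their equality. -/

section PeriodSums

variable {F : Type*} [Field F] [Fintype F]

lemma sum_mulChar_mul_inv_pow (A B : MulChar F ℂ) (hBA : B ^ 2 * A⁻¹ ≠ 1) (a b : F) :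
    ∑ c, A⁻¹ (a * c) * B (b * c ^ 2) = 0 := by
  have h : ∀ c, A⁻¹ (a * c) * B (b * c ^ 2) = A⁻¹ a * B b * (B ^ 2 * A⁻¹) c := by
    intro c
    rw [map_mul, map_mul, map_pow, MulChar.mul_apply, MulChar.pow_apply' _ two_ne_zero]
    ring
  simp_rw [h]
  rw [← mul_sum, MulChar.sum_eq_zero_of_ne_one hBA, mul_zero]

lemma jacobiSum_ne_zero {χ ψ : MulChar F ℂ} (hχ : χ ≠ 1) (hψ : ψ ≠ 1) : jacobiSum χ ψ ≠ 0 := by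
  by_cases h : χ * ψ = 1
  · rw [eq_inv_of_mul_eq_one_right h, jacobiSum_nontrivial_inv hχ, neg_ne_zero,
      MulChar.apply_ne_zero_iff]
    exact isUnit_one.neg
  · have hchar : ringChar ℂ ≠ ringChar F := by
      rw [ringChar.eq_zero]
      exact (CharP.ringChar_ne_zero_of_finite F).symm
    have := jacobiSum_mul_jacobiSum_inv hchar hχ hψ h
    intro h0
    rw [h0, zero_mul] at this
    exact Nat.cast_ne_zero.mpr Fintype.card_ne_zero this.symm

lemma period21_eq_sum (h2 : (2 : F) ≠ 0) (A B : MulChar F ℂ) {z : F} (hz' : z ≠ -1) :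
    B 4 * period21 A B (B ^ 2) (4 * z / (1 + z) ^ 2) =
      (A ^ 2) (1 + z) * ∑ t, B (1 - t ^ 2) * A⁻¹ (1 - 2 * t * z + z ^ 2) := by
  have hz1 : 1 + z ≠ 0 := fun h => hz' (eq_neg_of_add_eq_zero_right h)
  rw [period21, mul_sum, mul_sum]
  refine (Fintype.sum_equiv ((Equiv.addRight 1).trans (Equiv.mulRight₀ 2⁻¹ (inv_ne_zero h2)))
    _ _ fun t => ?_).symm
  simp only [Equiv.trans_apply, Equiv.coe_addRight, Equiv.mulRight₀_apply]
  set y := (t + 1) * 2⁻¹ with hy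
  rw [period10, show B⁻¹ * B ^ 2 = B by group]
  have e1 : 1 - t ^ 2 = 4 * y * (1 - y) := by rw [hy]; field_simp; ring
  have e2 : 1 - 4 * z / (1 + z) ^ 2 * y =
      (1 + z)⁻¹ * (1 + z)⁻¹ * (1 - 2 * t * z + z ^ 2) := by
    rw [hy]
    field_simp
    ring
  rw [e1, e2]
  simp only [map_mul, inv_apply_inv, MulChar.pow_apply' _ two_ne_zero]
  ring

variable [DecidableEq F]

/-- For fixed y ≠ 0, 1, an affine change from t to m fixing p, the zero in t of 1 - 2tz + z²,
absorbs the Jacobi summand into the characters; p² - 1 = ((z - 1/z)/2)² gives the coefficient of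
1/y. -/
lemma jacobiSum_mul_sum_left (h2 : (2 : F) ≠ 0) (A B : MulChar F ℂ) (hBA : B ^ 2 * A⁻¹ ≠ 1)
    {z : F} (hz0 : z ≠ 0) :
    jacobiSum (A * phi F * B⁻¹) (B ^ 2 * A⁻¹) *
        ∑ t, B (1 - t ^ 2) * A⁻¹ (1 - 2 * t * z + z ^ 2) =
      ∑ m, A⁻¹ (2 * z * m - 1 - z ^ 2) * ∑ y, phi F y *
        B (m * (z + z⁻¹) - 2 - ((m ^ 2 - 1) * y + ((z - z⁻¹) / 2) ^ 2 * y⁻¹)) := by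
  set p : F := (z + z⁻¹) / 2 with hp
  have hpz : 2 * z * p = 1 + z ^ 2 := by rw [hp]; field_simp; ring
  conv_rhs => simp only [mul_sum]
  rw [sum_comm, jacobiSum, sum_mul]
  refine sum_congr rfl fun y _ => ?_
  rcases eq_or_ne y 0 with rfl | hy0
  · simp [MulChar.map_zero]
  rcases eq_or_ne y 1 with rfl | hy1
  -- At y = 1 the affine map degenerates: the Jacobi summand is 0, and the other side is a complete
  -- sum of the nontrivial character `B ^ 2 * A⁻¹`.
  · rw [sub_self, MulChar.map_zero, mul_zero, zero_mul,
      ← sum_mulChar_mul_inv_pow A B hBA (2 * z) (-1)]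
    refine Fintype.sum_equiv (Equiv.addRight p) _ _ fun c => ?_
    rw [Equiv.coe_addRight, map_one, one_mul]
    congr 2
    · linear_combination -hpz
    · rw [hp]
      field_simp
      ring
  have hy1' : 1 - y ≠ 0 := sub_ne_zero.mpr hy1.symm
  rw [mul_sum]
  refine (Fintype.sum_equiv ((Equiv.subRight p).trans ((Equiv.mulLeft₀ (y / (1 - y))
    (div_ne_zero hy0 hy1')).trans (Equiv.subLeft p))) _ _ fun m => ?_).symm
  simp only [Equiv.trans_apply, Equiv.subRight_apply, Equiv.mulLeft₀_apply, Equiv.subLeft_apply]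
  set t := p - y / (1 - y) * (m - p) with ht
  have ht' : (1 - y) * t = p - m * y := by rw [ht]; field_simp; ring
  have e1 : 1 - 2 * t * z + z ^ 2 = y * (1 - y)⁻¹ * (2 * z * m - 1 - z ^ 2) := by
    rw [ht, sub_sub, ← hpz]
    field_simp
    linear_combination (y - 1) * hpz
  have e2 : m * (z + z⁻¹) - 2 - ((m ^ 2 - 1) * y + ((z - z⁻¹) / 2) ^ 2 * y⁻¹) =
      (1 - y) ^ 2 * y⁻¹ * (1 - t ^ 2) := by
    have e3 : (1 - y) ^ 2 * y⁻¹ * (1 - t ^ 2) = y⁻¹ * ((1 - y) ^ 2 - (p - m * y) ^ 2) := by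
      rw [← ht']
      ring
    rw [e3, hp]
    field_simp
    ring
  rw [e1, e2]
  simp only [map_mul, map_pow, MulChar.mul_apply, inv_inv,
    MulChar.pow_apply' _ two_ne_zero, ← MulChar.inv_apply']
  have hA : A⁻¹ (1 - y) * A (1 - y) = 1 := by
    rw [← MulChar.mul_apply, inv_mul_cancel, MulChar.one_apply hy1'.isUnit]
  have hA' : A⁻¹ y * A y = 1 := by
    rw [← MulChar.mul_apply, inv_mul_cancel, MulChar.one_apply hy0.isUnit]
  linear_combination (-(A⁻¹ (2 * z * m - 1 - z ^ 2) * phi F y * B (1 - y) ^ 2 * B⁻¹ y *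
    B (1 - t ^ 2))) * (hA + A⁻¹ (1 - y) * A (1 - y) * hA')

/-- Put x = zy: then x/z + z/x - 2 = (1 - y)²/y, and scaling u by this factor extracts J(φ, B) from
the inner sum. -/
lemma jacobiSum_mul_sum_right (A B : MulChar F ℂ) {z : F} (hz0 : z ≠ 0) :
    jacobiSum (phi F) B * ∑ y, (A * phi F * B⁻¹) y * (B ^ 2 * A⁻¹) (1 - y) * A⁻¹ (1 - z ^ 2 * y) =
      ∑ x ∈ univ.filter (fun x : F => x ≠ 0), A⁻¹ (z * (x + x⁻¹) - 1 - z ^ 2) *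
        ∑ u, phi F u * B (x / z + z / x - 2 - u) := by
  rw [sum_filter, mul_sum]
  refine (Fintype.sum_equiv (Equiv.mulRight₀ z⁻¹ (inv_ne_zero hz0)) _ _ fun x => ?_).symm
  obtain ⟨y, hy⟩ : ∃ y, y = x * z⁻¹ := ⟨_, rfl⟩
  rw [show Equiv.mulRight₀ z⁻¹ (inv_ne_zero hz0) x = y from hy.symm]
  rcases eq_or_ne x 0 with rfl | hx0
  · simp [hy, MulChar.map_zero]
  rw [if_pos hx0]
  have hy0 : y ≠ 0 := hy ▸ mul_ne_zero hx0 (inv_ne_zero hz0)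
  have e1 : z * (x + x⁻¹) - 1 - z ^ 2 = (1 - y) * y⁻¹ * (1 - z ^ 2 * y) := by
    rw [hy]
    field_simp
    ring
  have e2 : x / z + z / x - 2 = (1 - y) ^ 2 * y⁻¹ := by
    rw [hy]
    field_simp
    ring
  rw [e1, e2]
  rcases eq_or_ne y 1 with rfl | hy1
  · simp [MulChar.map_zero]
  have hy1' : 1 - y ≠ 0 := sub_ne_zero.mpr (Ne.symm hy1)
  have hk : (1 - y) ^ 2 * y⁻¹ ≠ 0 := mul_ne_zero (pow_ne_zero 2 hy1') (inv_ne_zero hy0)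
  have hsum : ∑ u, phi F u * B ((1 - y) ^ 2 * y⁻¹ - u) =
      phi F y * B (1 - y) ^ 2 * B⁻¹ y * jacobiSum (phi F) B := by
    rw [jacobiSum, mul_sum]
    refine (Fintype.sum_equiv (Equiv.mulLeft₀ _ hk) _ _ fun w => ?_).symm
    rw [Equiv.mulLeft₀_apply]
    rw [← mul_one_sub, map_mul, map_mul, map_mul B, map_mul B, phi_inv, phi_sq hy1', map_pow,
      MulChar.inv_apply']
    ring
  rw [hsum]
  simp only [map_mul, MulChar.mul_apply, inv_apply_inv, MulChar.pow_apply' _ two_ne_zero]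
  ring

lemma sum_quadratic_transformation (h2 : (2 : F) ≠ 0) (A B : MulChar F ℂ)
    (hBA : B ^ 2 * A⁻¹ ≠ 1) {z : F} (hz0 : z ≠ 0) (hz : z ≠ 1) (hz' : z ≠ -1) :
    jacobiSum (A * phi F * B⁻¹) (B ^ 2 * A⁻¹) *
        ∑ t, B (1 - t ^ 2) * A⁻¹ (1 - 2 * t * z + z ^ 2) =
      jacobiSum (phi F) B *
        ∑ y, (A * phi F * B⁻¹) y * (B ^ 2 * A⁻¹) (1 - y) * A⁻¹ (1 - z ^ 2 * y) := by
  rw [jacobiSum_mul_sum_left h2 A B hBA hz0, jacobiSum_mul_sum_right A B hz0,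
    ← sum_filter_ne_zero_fiberwise _ (fun x => x + x⁻¹)]
  refine Fintype.sum_equiv (Equiv.mulLeft₀ 2 h2) _ _ fun m => ?_
  rw [Equiv.mulLeft₀_apply,
    sum_phi_mul_eq_sum_fiber h2 hz0 hz hz' (fun v => B (m * (z + z⁻¹) - 2 - v)) m, mul_sum]
  refine sum_congr rfl fun x hx => ?_
  rw [(mem_filter.mp hx).2.2]
  congr 1
  · ring_nf
  · refine sum_congr rfl fun u _ => ?_
    ring_nf

/-- The duplication formula `J(B, B) B(4) = J(φ, B)`. -/
lemma jacobiSum_self_mul (hF : ringChar F ≠ 2) {B : MulChar F ℂ} (hB : B ≠ 1) :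
    jacobiSum B B * B 4 = jacobiSum (phi F) B := by
  have h2 : (2 : F) ≠ 0 := Ring.two_ne_zero hF
  have e1 : jacobiSum B B * B 4 = ∑ t, B (1 - t ^ 2) := by
    rw [jacobiSum, sum_mul]
    refine (Fintype.sum_equiv ((Equiv.addRight 1).trans (Equiv.mulRight₀ 2⁻¹ (inv_ne_zero h2)))
      _ _ fun t => ?_).symm
    simp only [Equiv.trans_apply, Equiv.coe_addRight, Equiv.mulRight₀_apply]
    rw [← map_mul, ← map_mul]
    congr 1
    field_simp
    ring
  -- An element w has φ(w) + 1 square roots.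
  have e2 : ∑ t, B (1 - t ^ 2) = ∑ w, (phi F w + 1) * B (1 - w) := by
    rw [← sum_fiberwise univ (fun t : F => t ^ 2)]
    refine sum_congr rfl fun w _ => ?_
    have : ∀ t ∈ univ.filter (fun t : F => t ^ 2 = w), B (1 - t ^ 2) = B (1 - w) := by
      intro t ht
      rw [(mem_filter.mp ht).2]
    rw [sum_congr rfl this, sum_const, nsmul_eq_mul]
    congr 1
    have hc := quadraticChar_card_sqrts hF w
    have hs : {x : F | x ^ 2 = w}.toFinset = univ.filter (fun t : F => t ^ 2 = w) := by
      ext; simp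
    rw [hs] at hc
    rw [phi_apply]
    exact_mod_cast hc
  have e3 : ∑ w : F, B (1 - w) = 0 := by
    rw [← MulChar.sum_eq_zero_of_ne_one hB]
    exact Fintype.sum_equiv (Equiv.subLeft 1) _ _ fun w => rfl
  rw [e1, e2, jacobiSum]
  simp_rw [add_mul, one_mul]
  rw [sum_add_distrib, e3, add_zero]

end PeriodSums

end FFHyp

theorem mainTheorem11 {F : Type*} [Field F] [Fintype F] [DecidableEq F]
    (hF : ringChar F ≠ 2) (A B : MulChar F ℂ)
    (hB : B ≠ 1) (hBA : B ^ 2 * A⁻¹ ≠ 1) (hAB : A * B⁻¹ * FFHyp.phi F ≠ 1)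
    (z : F) (hz : z ≠ 1) (hz' : z ≠ -1) :
    FFHyp.hyp21 A B (B ^ 2) (4 * z / (1 + z) ^ 2) =
      (A ^ 2) (1 + z) *
        FFHyp.hyp21 A (A * FFHyp.phi F * B⁻¹) (B * FFHyp.phi F) (z ^ 2) := by
  have h2 : (2 : F) ≠ 0 := Ring.two_ne_zero hF
  have hφ : FFHyp.phi F * FFHyp.phi F = 1 := by
    ext a
    rw [MulChar.mul_apply, FFHyp.phi_mul_self a.ne_zero, MulChar.one_apply_coe]
  have hφ' : (FFHyp.phi F)⁻¹ = FFHyp.phi F := inv_eq_of_mul_eq_one_right hφ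
  set C := A * FFHyp.phi F * B⁻¹ with hC
  have hC1 : C ≠ 1 := by rwa [hC, mul_right_comm]
  have hD : B * FFHyp.phi F * C⁻¹ = B ^ 2 * A⁻¹ := by
    rw [hC, mul_inv, mul_inv, inv_inv, hφ']
    calc B * FFHyp.phi F * (A⁻¹ * FFHyp.phi F * B) = B ^ 2 * A⁻¹ * (FFHyp.phi F * FFHyp.phi F) := by
          rw [sq]; ac_rfl
      _ = B ^ 2 * A⁻¹ := by rw [hφ, mul_one]
  have hBB : B ^ 2 * B⁻¹ = B := by group
  have hJB : jacobiSum B B ≠ 0 := FFHyp.jacobiSum_ne_zero hB hB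
  have hJC : jacobiSum C (B ^ 2 * A⁻¹) ≠ 0 := FFHyp.jacobiSum_ne_zero hC1 hBA
  rw [FFHyp.hyp21, FFHyp.hyp21, hD, hBB]
  rcases eq_or_ne z 0 with rfl | hz0
  -- At z = 0, where x = zy is not invertible, each period equals its own normalizing Jacobi sum.
  · have e0 : ∀ X Y Z : MulChar F ℂ, FFHyp.period21 X Y Z 0 = jacobiSum Y (Z * Y⁻¹) := by
      intro X Y Z
      simp [FFHyp.period21, FFHyp.period10, jacobiSum, mul_comm]
    simp only [mul_zero, zero_div, zero_pow two_ne_zero, e0, hD, hBB, add_zero, map_one]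
    rw [one_div_mul_cancel hJB, one_div_mul_cancel hJC, mul_one]
  · have hR : FFHyp.period21 A C (B * FFHyp.phi F) (z ^ 2) =
        ∑ y, C y * (B ^ 2 * A⁻¹) (1 - y) * A⁻¹ (1 - z ^ 2 * y) := by
      rw [← hD, mul_comm _ C⁻¹]
      rfl
    have hB4 : B 4 ≠ 0 := by
      rw [MulChar.apply_ne_zero_iff, show (4 : F) = 2 * 2 by norm_num]
      exact (mul_ne_zero h2 h2).isUnit
    have hL := FFHyp.period21_eq_sum h2 A B hz'
    have hT := FFHyp.sum_quadratic_transformation h2 A B hBA hz0 hz hz'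
    rw [← hC, ← hR, ← FFHyp.jacobiSum_self_mul hF hB] at hT
    rw [one_div, one_div, inv_mul_eq_iff_eq_mul₀ hJB]
    apply mul_left_cancel₀ hB4
    rw [hL]
    generalize ∑ t, B (1 - t ^ 2) * A⁻¹ (1 - 2 * t * z + z ^ 2) = S at hT ⊢
    field_simp
    linear_combination (A ^ 2) (1 + z) * hT
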